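/- Consider the mean-field Blume–Capel model. Let $\rho_\beta$ be the probability measure on $\{-1,0,1\}$ with weights proportional to $e^{-\beta\omega^2}$, let $c_\beta(t)=\log\int e^{t\omega}\,\rho_\beta(d\omega)=\log\frac{1+e^{-\beta}(e^t+e^{-t})}{1+2e^{-\beta}}$, and let $J_\beta(x)=\sup_{t\in\mathbb R}\{tx-c_\beta(t)\}$ for $x\in[-1,1]$. For $\beta,K>0$ let $$I_{\beta,K}(x)=J_\beta(x)-\beta Kx^2-\inf_{y\in[-1,1]}\{J_\beta(y)-\beta Ky^2\},\qquad \mathcal M_{\beta,K}=\{x\in[-1,1]: I_{\beta,K}(x)=0\},$$ and let $G_{\beta,K}(x)=\beta Kx^2-c_\beta(2\beta Kx)$ for $x\in\mathbb R$. When $\mathcal M_{\beta,K}$ contains exactly one positive point, that point is denoted $m(\beta,K)$. Put $\beta_c=\log 4$, $K(\beta)=(e^\beta+2)/(4\beta)$ and $c_4(\beta)=(e^\beta+2)^2(4-e^\beta)/(8\cdot 4!)$. Let $0<\beta<\beta_c$, $\alpha>0$, $b\in\{1,0,-1\}$, let $k$ be a real number with $k\neq K'(\beta)b$, and define $$\beta_n=\beta+\frac{b}{n^\alpha},\qquad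 K_n=K(\beta)+\frac{k}{n^\alpha}.$$ Then $(\beta_n,K_n)\to(\beta,K(\beta))$, and the following hold. (a) As $n\to\infty$, $n^{2\alpha}\,G_{\beta_n,K_n}(x/n^{\alpha/2})\to g(x)=\beta(K'(\beta)b-k)x^2+c_4(\beta)x^4$, uniformly for $x$ in compact subsets of $\mathbb R$. (b) The polynomial $g$ has nonzero global minimum points if and only if $K'(\beta)b-k<0$. If this inequality holds, the global minimum points of $g$ are exactly $\pm\bar x$, where $$\bar x=\left(\frac{\beta(k-K'(\beta)b)}{2c_4(\beta)}\right)^{1/2}>0.$$ (c) Assume $K'(\beta)b-k<0$. Then for all sufficiently large $n$, $\mathcal M_{\beta_n,K_n}=\{\pm m(\beta_n,K_n)\}$ with $m(\beta_n,K_n)>0$; moreover $m(\beta_n,K_n)\to0$ and $$m(\beta_n,K_n)\sim\frac{\bar x}{n^{\alpha/2}},\qquad\text{i.e.}\qquad \lim_{n\to\infty}n^{\alpha/2}m(\beta_n,K_n)=\bar x.$$ If $b\neq0$, this becomes $m(\beta_n,K_n)\sim\bar x\,|\beta-\beta_n|^{1/2}$. -/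

import Mathlib

open Real Set Filter Topology MeasureTheory ProbabilityTheory Asymptotics

noncomputable section

namespace BlumeCapel

/-- The uniform distribution on the spin values `-1, 0, 1`, as a measure on `ℝ`. -/
def spinLaw : Measure ℝ :=
  (3 : ENNReal)⁻¹ • (Measure.dirac (-1) + Measure.dirac 0 + Measure.dirac 1)

/-- The tilted single-spin law `ρ_β(dω) = exp(-β ω²) ρ(dω) / Z(β)`, where `ρ` is `spinLaw`. -/
def tiltedSpinLaw (β : ℝ) : Measure ℝ :=
  spinLaw.tilted (fun ω => -β * ω ^ 2)

/-- The cumulant generating function `c_β(t) = log ∫ exp(t ω) ρ_β(dω)`. -/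
def cumulant (β t : ℝ) : ℝ :=
  cgf id (tiltedSpinLaw β) t

/-- The Legendre-Fenchel transform `J_β(x) = sup_t {t x - c_β(t)}`; the supremum is finite for
`x ∈ [-1, 1]`, which is the only range where it is used. -/
def legendre (β x : ℝ) : ℝ :=
  ⨆ t : ℝ, (t * x - cumulant β t)

/-- The large deviation rate function
`I_{β,K}(x) = J_β(x) - β K x² - inf_{y ∈ [-1,1]} {J_β(y) - β K y²}`. -/
def rateFunction (β K x : ℝ) : ℝ :=
  legendre β x - β * K * x ^ 2 -
    sInf ((fun y : ℝ => legendre β y - β * K * y ^ 2) '' Icc (-1) 1)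

/-- The set of equilibrium macrostates `{x ∈ [-1, 1] : I_{β,K}(x) = 0}`. -/
def equilibriumSet (β K : ℝ) : Set ℝ :=
  {x | x ∈ Icc (-1 : ℝ) 1 ∧ rateFunction β K x = 0}

/-- The magnetization `m(β, K)`: the positive equilibrium macrostate. It is meaningful where
there is exactly one (the supremum is then the supremum of a one-point set). -/
def magnetization (β K : ℝ) : ℝ :=
  sSup {x | 0 < x ∧ x ∈ equilibriumSet β K}

/-- The free-energy functional `G_{β,K}(x) = β K x² - c_β(2 β K x)`. -/
def freeEnergy (β K x : ℝ) : ℝ :=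
  β * K * x ^ 2 - cumulant β (2 * β * K * x)

/-- The critical inverse temperature `β_c = log 4`. -/
def criticalBeta : ℝ := Real.log 4

/-- The second-order curve `K(β) = (e^β + 2) / (4 β)`. -/
def criticalK (β : ℝ) : ℝ := (exp β + 2) / (4 * β)

/-- The quartic coefficient `c₄(β) = (e^β + 2)² (4 - e^β) / (8 · 4!)`. -/
def quarticCoeff (β : ℝ) : ℝ :=
  (exp β + 2) ^ 2 * (4 - exp β) / (8 * (Nat.factorial 4 : ℝ))

/-- `β_n = β + b / n^α`. -/
def betaSeq (β b α : ℝ) (n : ℕ) : ℝ := β + b / (n : ℝ) ^ α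

/-- `K_n = K(β) + k / n^α`. -/
def kSeq (β k α : ℝ) (n : ℕ) : ℝ := criticalK β + k / (n : ℝ) ^ α

/-- The Ginzburg-Landau polynomial `g(x) = β (K'(β) b - k) x² + c₄(β) x⁴`. -/
def ginzburgLandau (β b k x : ℝ) : ℝ :=
  β * (deriv criticalK β * b - k) * x ^ 2 + quarticCoeff β * x ^ 4

/-- `x̄ = (β (k - K'(β) b) / (2 c₄(β)))^{1/2}`. -/
def xBar (β b k : ℝ) : ℝ :=
  √(β * (k - deriv criticalK β * b) / (2 * quarticCoeff β))

/-- `x` is a global minimum point of `f : ℝ → ℝ`. -/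
def IsGlobalMinPoint (f : ℝ → ℝ) (x : ℝ) : Prop := ∀ y, f x ≤ f y

/-- The closed form of the cumulant generating function. -/
theorem cumulant_eq (β t : ℝ) :
    cumulant β t =
      Real.log ((1 + exp (-β) * (exp t + exp (-t))) / (1 + 2 * exp (-β))) := by
  have hint : ∀ f : ℝ → ℝ, ∫ x, f x ∂spinLaw = (f (-1) + f 0 + f 1) / 3 := by
    intro f
    have hf : ∀ a : ℝ, Integrable f (Measure.dirac a) := fun a =>
      integrable_dirac (by simp)
    rw [spinLaw, integral_smul_measure,
      integral_add_measure ((hf _).add_measure (hf _)) (hf _),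
      integral_add_measure (hf _) (hf _)]
    simp
    ring
  have h := integral_tilted (μ := spinLaw) (fun ω : ℝ => -β * ω ^ 2) (fun ω => exp (t * ω))
  rw [cumulant, cgf, mgf, tiltedSpinLaw]
  simp only [id]
  rw [h, hint, hint]
  congr 1
  have : (0 : ℝ) < 1 + 2 * exp (-β) := by positivity
  simp
  field_simp
  ring

end BlumeCapel

end

/-! By convex duality, the zeros of the rate function are the global minimum points of `freeEnergy`:
taking t = 2βKx in the Legendre supremum gives G(x) ≤ J(x) - βKx², with equality where x = c'(2βKx)
(`equilibriumSet_eq`). So everything is read off from G.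

A fourth-order Taylor bound for the cumulant, uniform in β, shows that near the second-order curve
and at scale n^(-α/2) the quadratic and quartic terms of G are both of order n^(-2α), while the
remainder is smaller. This is (a). The limit is an explicit quartic, and completing the square gives
(b).

For (c), when β < β_c, G is unimodal on [0, ∞) as soon as it takes a negative value there
(`exists_freeEnergy_unimodal`); g(x̄) < 0 provides such a value for large n. Unimodality locates the
minimum by comparing G at two points, so pointwise convergence to g already gives the limit of
n^(α/2) m. -/

noncomputable section

namespace BlumeCapel

/-! ### The cumulant generating function and its convexity -/

/-- The variance of the tilted single-spin law. -/
def spinVariance (β : ℝ) : ℝ := 2 / (exp β + 2)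

theorem spinVariance_pos (β : ℝ) : 0 < spinVariance β := by
  unfold spinVariance; positivity

theorem spinVariance_lt_one (β : ℝ) : spinVariance β < 1 := by
  unfold spinVariance
  rw [div_lt_one (by positivity)]
  linarith [exp_pos β]

theorem one_third_lt_spinVariance {β : ℝ} (h : β < criticalBeta) : 1 / 3 < spinVariance β := by
  have h4 : exp β < 4 := by
    have := exp_lt_exp.2 h
    rwa [criticalBeta, exp_log (by norm_num)] at this
  unfold spinVariance
  rw [div_lt_div_iff₀ (by norm_num) (by positivity)]
  linarith

theorem partition_pos (β t : ℝ) : 0 < 1 + spinVariance β * (cosh t - 1) := by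
  have := mul_nonneg (spinVariance_pos β).le (sub_nonneg.2 (one_le_cosh t))
  linarith

/-- With p the mass of {-1, 1}, which is also the variance, the law has weights 1 - p, p/2, p/2; β
enters only through p. -/
theorem cumulant_eq_log_cosh (β t : ℝ) :
    cumulant β t = Real.log (1 + spinVariance β * (cosh t - 1)) := by
  rw [cumulant_eq, spinVariance, cosh_eq, exp_neg β]
  congr 1
  have := exp_pos β
  field_simp
  ring

theorem cumulant_neg (β t : ℝ) : cumulant β (-t) = cumulant β t := by
  simp [cumulant_eq_log_cosh]

/-- The derivative of the cumulant generating function. -/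
def cumulantDeriv (β t : ℝ) : ℝ :=
  spinVariance β * sinh t / (1 + spinVariance β * (cosh t - 1))

theorem hasDerivAt_cumulant (β t : ℝ) : HasDerivAt (cumulant β) (cumulantDeriv β t) t := by
  have h : cumulant β = fun t => Real.log (1 + spinVariance β * (cosh t - 1)) :=
    funext (cumulant_eq_log_cosh β)
  rw [h]
  exact ((((hasDerivAt_cosh t).sub_const 1).const_mul _).const_add 1).log (partition_pos β t).ne'

theorem continuous_cumulantDeriv (β : ℝ) : Continuous (cumulantDeriv β) := by
  unfold cumulantDeriv
  exact (continuous_const.mul continuous_sinh).div₀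
    (continuous_const.add (continuous_const.mul (continuous_cosh.sub continuous_const)))
    fun t => (partition_pos β t).ne'

/-- The bound confines critical points of G to [-1, 1] and makes G' positive at 1 when βK > 0. -/
theorem abs_cumulantDeriv_lt_one (β t : ℝ) : |cumulantDeriv β t| < 1 := by
  rw [cumulantDeriv, abs_div, abs_of_pos (partition_pos β t), div_lt_one (partition_pos β t),
    abs_mul, abs_of_pos (spinVariance_pos β)]
  have h : |sinh t| < cosh t := by
    rw [abs_lt, sinh_eq, cosh_eq]
    constructor <;> linarith [exp_pos t, exp_pos (-t)]
  nlinarith [spinVariance_pos β, spinVariance_lt_one β, h]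

/-- Tangent-line inequality expressing the convexity of the cumulant generating function. -/
theorem cumulant_tangent_le (β s t : ℝ) :
    cumulant β s + cumulantDeriv β s * (t - s) ≤ cumulant β t := by
  have hs := partition_pos β s
  have ht := partition_pos β t
  rw [cumulant_eq_log_cosh β s, cumulant_eq_log_cosh β t, cumulantDeriv]
  set p := spinVariance β with hp
  have hp0 : 0 < p := spinVariance_pos β
  have hp1 : p < 1 := spinVariance_lt_one β
  set Z := 1 + p * (cosh s - 1) with hZ
  set m := p * sinh s / Z * (t - s) with hm
  have hmZ : m * Z = p * sinh s * (t - s) := by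
    rw [hm]; field_simp
  -- Apply 1 + y ≤ e^y with y = ω(t - s) - m at each spin value ω and average with weights 1 - p,
  -- p/2, p/2. The first-order terms cancel by the choice of m (`hmZ`).
  have key : exp m * Z ≤ 1 + p * (cosh t - 1) := by
    have e0 : exp m * (1 - m) ≤ 1 := by
      have := mul_le_mul_of_nonneg_left (add_one_le_exp (-m)) (exp_pos m).le
      rw [← exp_add] at this
      simp only [add_neg_cancel, exp_zero] at this
      linarith
    have e1 : exp m * exp s * (1 + (t - s) - m) ≤ exp t := by
      have := mul_le_mul_of_nonneg_left (add_one_le_exp (t - s - m))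
        (mul_pos (exp_pos m) (exp_pos s)).le
      rw [← exp_add, ← exp_add, show m + s + (t - s - m) = t by ring, exp_add] at this
      linarith
    have e2 : exp m * exp (-s) * (1 - (t - s) - m) ≤ exp (-t) := by
      have := mul_le_mul_of_nonneg_left (add_one_le_exp (-(t - s) - m))
        (mul_pos (exp_pos m) (exp_pos (-s))).le
      rw [← exp_add, ← exp_add, show m + -s + (-(t - s) - m) = -t by ring, exp_add] at this
      linarith
    have e0' := mul_le_mul_of_nonneg_left e0 (sub_nonneg.2 hp1.le)
    have e1' := mul_le_mul_of_nonneg_left e1 (half_pos hp0).le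
    have e2' := mul_le_mul_of_nonneg_left e2 (half_pos hp0).le
    have hid : exp m * Z = (1 - p) * (exp m * (1 - m)) +
        p / 2 * (exp m * exp s * (1 + (t - s) - m)) +
        p / 2 * (exp m * exp (-s) * (1 - (t - s) - m)) := by
      have : exp m * (m * Z) = exp m * (p * sinh s * (t - s)) := by rw [hmZ]
      rw [hZ, cosh_eq, sinh_eq] at this
      rw [hZ, cosh_eq]
      linear_combination this
    rw [hid, cosh_eq]
    linarith
  calc Real.log Z + m = Real.log (exp m * Z) := by
        rw [Real.log_mul (exp_pos m).ne' hs.ne', Real.log_exp]; ring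
    _ ≤ _ := Real.log_le_log (mul_pos (exp_pos m) hs) key

/-! ### Legendre duality and equilibrium macrostates -/

theorem bddAbove_legendre (β : ℝ) {x : ℝ} (hx : x ∈ Icc (-1 : ℝ) 1) :
    BddAbove (range fun t : ℝ => t * x - cumulant β t) := by
  have hp0 := spinVariance_pos β
  have hp1 := spinVariance_lt_one β
  -- For |x| ≤ 1, e^(tx) ≤ 2 cosh t, and p cosh t is at most the partition function because p < 1.
  refine ⟨-Real.log (spinVariance β / 2), ?_⟩
  rintro _ ⟨t, rfl⟩
  have h1 : exp (t * x) ≤ exp t + exp (-t) := by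
    rcases le_total 0 t with h | h
    · have : exp (t * x) ≤ exp t := exp_le_exp.2 (by nlinarith [hx.2])
      linarith [exp_pos (-t)]
    · have : exp (t * x) ≤ exp (-t) := exp_le_exp.2 (by nlinarith [hx.1])
      linarith [exp_pos t]
  have h2 : spinVariance β / 2 * exp (t * x) ≤ 1 + spinVariance β * (cosh t - 1) := by
    rw [cosh_eq]
    nlinarith
  have h3 := Real.log_le_log (by positivity) h2
  rw [Real.log_mul (by positivity) (exp_pos _).ne', Real.log_exp] at h3
  simp only [cumulant_eq_log_cosh]
  linarith

theorem le_legendre (β : ℝ) {x : ℝ} (hx : x ∈ Icc (-1 : ℝ) 1) (t : ℝ) :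
    t * x - cumulant β t ≤ legendre β x :=
  le_ciSup (bddAbove_legendre β hx) t

theorem legendre_cumulantDeriv (β t : ℝ) :
    legendre β (cumulantDeriv β t) = t * cumulantDeriv β t - cumulant β t := by
  refine le_antisymm (ciSup_le fun s => ?_) (le_legendre β ?_ t)
  · linarith [cumulant_tangent_le β t s]
  · exact abs_le.1 (abs_cumulantDeriv_lt_one β t).le

theorem freeEnergy_neg (β K x : ℝ) : freeEnergy β K (-x) = freeEnergy β K x := by
  unfold freeEnergy
  rw [mul_neg, cumulant_neg]; ring

/-- If the global minimum points of `G_{β,K}` are exactly `±m` and `m` is critical, then `±m` are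
exactly the equilibrium macrostates. -/
theorem equilibriumSet_eq {β K m : ℝ} (hcrit : m = cumulantDeriv β (2 * β * K * m))
    (hlt : ∀ x, x ≠ m → x ≠ -m → freeEnergy β K m < freeEnergy β K x) :
    equilibriumSet β K = {m, -m} := by
  have hle : ∀ x ∈ Icc (-1 : ℝ) 1, freeEnergy β K x ≤ legendre β x - β * K * x ^ 2 := by
    intro x hx
    have := le_legendre β hx (2 * β * K * x)
    unfold freeEnergy
    linarith
  have hneg := freeEnergy_neg β K m
  have hmin : ∀ x, freeEnergy β K m ≤ freeEnergy β K x := by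
    intro x
    by_cases h1 : x = m
    · rw [h1]
    by_cases h2 : x = -m
    · rw [h2, hneg]
    exact (hlt x h1 h2).le
  have hcrit' : -m = cumulantDeriv β (2 * β * K * -m) := by
    have : cumulantDeriv β (2 * β * K * -m) = -cumulantDeriv β (2 * β * K * m) := by
      simp [cumulantDeriv, neg_div]
    rw [this, ← hcrit]
  -- Equality case of `hle`: the supremum defining J(x) is attained at t = 2βKx.
  have hval : ∀ x, x = cumulantDeriv β (2 * β * K * x) →
      legendre β x - β * K * x ^ 2 = freeEnergy β K x := by
    intro x hx
    have := legendre_cumulantDeriv β (2 * β * K * x)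
    rw [← hx] at this
    rw [this, freeEnergy]; ring
  have hmem : ∀ x, x = cumulantDeriv β (2 * β * K * x) → x ∈ Icc (-1 : ℝ) 1 := by
    intro x hx
    rw [hx]
    exact abs_le.1 (abs_cumulantDeriv_lt_one β _).le
  have hinf : sInf ((fun y : ℝ => legendre β y - β * K * y ^ 2) '' Icc (-1) 1) =
      freeEnergy β K m := by
    refine IsLeast.csInf_eq ⟨⟨m, hmem m hcrit, hval m hcrit⟩, ?_⟩
    rintro _ ⟨y, hy, rfl⟩
    exact (hmin y).trans (hle y hy)
  ext x
  simp only [equilibriumSet, rateFunction, hinf, mem_ofPred_eq, mem_insert_iff, mem_singleton_iff]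
  constructor
  · rintro ⟨hx, h0⟩
    by_contra! hne
    have := hlt x hne.1 hne.2
    linarith [hle x hx]
  · rintro (rfl | rfl)
    · exact ⟨hmem _ hcrit, by rw [hval _ hcrit, sub_self]⟩
    · exact ⟨hmem _ hcrit', by rw [hval _ hcrit', hneg, sub_self]⟩

theorem magnetization_eq {β K m : ℝ} (hm : 0 < m) (h : equilibriumSet β K = {m, -m}) :
    magnetization β K = m := by
  have : {x | 0 < x ∧ x ∈ equilibriumSet β K} = {m} := by
    ext x
    simp only [h, mem_ofPred_eq, mem_insert_iff, mem_singleton_iff]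
    constructor
    · rintro ⟨hx, rfl | rfl⟩
      · rfl
      · linarith
    · rintro rfl
      exact ⟨hm, Or.inl rfl⟩
  rw [magnetization, this, csSup_singleton]

/-! ### Unimodality of the free energy -/

/-- The ratio `t (1 - p + p cosh t) / sinh t`, whose level `2 β K p` determines the positive
critical points of `G_{β,K}`, is strictly increasing for `p > 1/3`. -/
theorem strictMonoOn_criticalRatio {p : ℝ} (hp : 1 / 3 < p) :
    StrictMonoOn (fun t : ℝ => t * (1 + p * (cosh t - 1)) / sinh t) (Ioi 0) := by
  -- This function is the numerator of the ratio's derivative over sinh². It vanishes at 0, so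
  -- positivity follows from that of its own derivative.
  have hder : ∀ t : ℝ, HasDerivAt
      (fun t : ℝ => (1 - p) * (sinh t - t * cosh t) + p * (sinh t * cosh t - t))
      (sinh t * (2 * p * sinh t - (1 - p) * t)) t := by
    intro t
    have h := (((hasDerivAt_sinh t).sub ((hasDerivAt_id' t).mul (hasDerivAt_cosh t))).const_mul
      (1 - p)).add ((((hasDerivAt_sinh t).mul (hasDerivAt_cosh t)).sub
        (hasDerivAt_id' t)).const_mul p)
    refine h.congr_deriv ?_
    have := cosh_sq t
    linear_combination p * this
  have hE : ∀ t : ℝ, 0 < t →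
      0 < (1 - p) * (sinh t - t * cosh t) + p * (sinh t * cosh t - t) := by
    have hmono : StrictMonoOn
        (fun t : ℝ => (1 - p) * (sinh t - t * cosh t) + p * (sinh t * cosh t - t)) (Ici 0) := by
      refine strictMonoOn_of_deriv_pos (convex_Ici 0)
        (fun t _ => (hder t).continuousAt.continuousWithinAt) fun t ht => ?_
      rw [interior_Ici] at ht
      have ht' : 0 < t := ht
      rw [(hder t).deriv]
      have hs : t < sinh t := self_lt_sinh_iff.2 ht'
      refine mul_pos (ht'.trans hs) ?_
      -- Since sinh t > t, the factor exceeds (3p - 1)t; this is where p > 1/3 enters.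
      nlinarith
    intro t ht
    simpa using hmono self_mem_Ici ht.le ht
  have hd : ∀ t : ℝ, 0 < t → HasDerivAt (fun t : ℝ => t * (1 + p * (cosh t - 1)) / sinh t)
      (((1 - p) * (sinh t - t * cosh t) + p * (sinh t * cosh t - t)) / sinh t ^ 2) t := by
    intro t ht
    have h := (((hasDerivAt_id' t).mul
      ((((hasDerivAt_cosh t).sub_const 1).const_mul p).const_add 1))).div
      (hasDerivAt_sinh t) (sinh_pos_iff.2 ht).ne'
    refine h.congr_deriv ?_
    congr 1
    simp only [Pi.mul_apply]
    have := cosh_sq t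
    linear_combination (-(t * p)) * this
  refine strictMonoOn_of_deriv_pos (convex_Ioi 0)
    (fun t ht => (hd t ht).continuousAt.continuousWithinAt) fun t ht => ?_
  rw [interior_Ioi] at ht
  rw [(hd t ht).deriv]
  exact div_pos (hE t ht) (pow_pos (sinh_pos_iff.2 ht) 2)

theorem hasDerivAt_freeEnergy (β K x : ℝ) :
    HasDerivAt (freeEnergy β K) (2 * (β * K) * (x - cumulantDeriv β (2 * β * K * x))) x := by
  have h := (((hasDerivAt_id' x).pow 2).const_mul (β * K)).sub
    ((hasDerivAt_cumulant β (2 * β * K * x)).comp x ((hasDerivAt_id' x).const_mul (2 * β * K)))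
  refine h.congr_deriv ?_
  norm_num
  ring

theorem freeEnergy_zero (β K : ℝ) : freeEnergy β K 0 = 0 := by
  simp [freeEnergy, cumulant_eq_log_cosh]

/-- The sign of `G'` at a positive point is the sign of the critical ratio minus its level. -/
theorem sub_cumulantDeriv_eq {β A x : ℝ} (hA : 0 < A) (hx : 0 < x) :
    2 * A * (x - cumulantDeriv β (2 * A * x)) =
      sinh (2 * A * x) / (1 + spinVariance β * (cosh (2 * A * x) - 1)) *
        ((2 * A * x) * (1 + spinVariance β * (cosh (2 * A * x) - 1)) / sinh (2 * A * x) -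
          2 * A * spinVariance β) := by
  have h1 := partition_pos β (2 * A * x)
  have h2 : 0 < sinh (2 * A * x) := sinh_pos_iff.2 (by positivity)
  rw [cumulantDeriv]
  field_simp

/-- Below the tricritical point, if `G_{β,K}` takes a negative value then on `[0, ∞)` it first
decreases strictly to a positive critical point and then increases strictly. -/
theorem exists_freeEnergy_unimodal {β K x₀ : ℝ} (hβ : β < criticalBeta) (hA : 0 < β * K)
    (hx₀ : 0 < x₀) (hneg : freeEnergy β K x₀ < 0) :
    ∃ m, 0 < m ∧ m = cumulantDeriv β (2 * β * K * m) ∧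
      StrictAntiOn (freeEnergy β K) (Icc 0 m) ∧ StrictMonoOn (freeEnergy β K) (Ici m) := by
  have hcont : Continuous (freeEnergy β K) :=
    continuous_iff_continuousAt.2 fun x => (hasDerivAt_freeEnergy β K x).continuousAt
  have hmono := strictMonoOn_criticalRatio (one_third_lt_spinVariance hβ)
  -- As G(0) = 0 > G(x₀), the mean value theorem gives q with G'(q) < 0. Then q < c' < 1, and the
  -- sign change between q and 1 yields the critical point.
  obtain ⟨q, hq, hq'⟩ := exists_hasDerivAt_eq_slope (freeEnergy β K) _ hx₀ hcont.continuousOn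
    fun x _ => hasDerivAt_freeEnergy β K x
  rw [freeEnergy_zero, sub_zero, sub_zero] at hq'
  have hqneg : q - cumulantDeriv β (2 * β * K * q) < 0 := by
    have h : 2 * (β * K) * (q - cumulantDeriv β (2 * β * K * q)) < 0 := by
      rw [hq']; exact div_neg_of_neg_of_pos hneg hx₀
    by_contra! h'
    exact absurd h (not_lt.2 (by positivity))
  have hlt1 : ∀ t, cumulantDeriv β t < 1 := fun t => (abs_lt.1 (abs_cumulantDeriv_lt_one β t)).2
  have hq1 : q ≤ 1 := by linarith [hlt1 (2 * β * K * q)]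
  have hc : Continuous fun x => x - cumulantDeriv β (2 * β * K * x) :=
    continuous_id.sub ((continuous_cumulantDeriv β).comp (continuous_const.mul continuous_id))
  obtain ⟨m, hm, hm0⟩ := intermediate_value_Icc hq1 hc.continuousOn
    (show (0 : ℝ) ∈ Icc _ _ from ⟨hqneg.le, (sub_pos.2 (hlt1 _)).le⟩)
  simp only at hm0
  have hmpos : 0 < m := hq.1.trans_le hm.1
  have hsign : ∀ x, 0 < x → 2 * (β * K) * (x - cumulantDeriv β (2 * β * K * x)) =
      sinh (2 * (β * K) * x) / (1 + spinVariance β * (cosh (2 * (β * K) * x) - 1)) *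
        ((2 * (β * K) * x) * (1 + spinVariance β * (cosh (2 * (β * K) * x) - 1)) /
          sinh (2 * (β * K) * x) - 2 * (β * K) * spinVariance β) := by
    intro x hx
    rw [← sub_cumulantDeriv_eq hA hx]
    simp only [mul_assoc]
  have hfac : ∀ x, 0 < x →
      0 < sinh (2 * (β * K) * x) / (1 + spinVariance β * (cosh (2 * (β * K) * x) - 1)) :=
    fun x hx => div_pos (sinh_pos_iff.2 (by positivity)) (partition_pos β _)
  have hlevel : (2 * (β * K) * m) * (1 + spinVariance β * (cosh (2 * (β * K) * m) - 1)) /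
      sinh (2 * (β * K) * m) = 2 * (β * K) * spinVariance β := by
    have h := hsign m hmpos
    rw [hm0, mul_zero] at h
    rcases mul_eq_zero.1 h.symm with h | h
    · exact absurd h (hfac m hmpos).ne'
    · linarith
  refine ⟨m, hmpos, by linarith, ?_, ?_⟩
  · refine strictAntiOn_of_deriv_neg (convex_Icc 0 m) hcont.continuousOn fun x hx => ?_
    rw [interior_Icc] at hx
    rw [(hasDerivAt_freeEnergy β K x).deriv, hsign x hx.1]
    refine mul_neg_of_pos_of_neg (hfac x hx.1) (sub_neg.2 ?_)
    rw [← hlevel]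
    have h1 := hx.1
    have h2 := hx.2
    exact hmono (show 0 < 2 * (β * K) * x by positivity) (show 0 < 2 * (β * K) * m by positivity)
      (by gcongr)
  · refine strictMonoOn_of_deriv_pos (convex_Ici m) hcont.continuousOn fun x hx => ?_
    rw [interior_Ici] at hx
    have h2 : m < x := hx
    have h1 : 0 < x := hmpos.trans h2
    rw [(hasDerivAt_freeEnergy β K x).deriv, hsign x h1]
    refine mul_pos (hfac x h1) (sub_pos.2 ?_)
    rw [← hlevel]
    exact hmono (show 0 < 2 * (β * K) * m by positivity) (show 0 < 2 * (β * K) * x by positivity)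
      (by gcongr)

theorem equilibriumSet_eq_of_unimodal {β K m : ℝ} (hm : 0 < m)
    (hcrit : m = cumulantDeriv β (2 * β * K * m))
    (hanti : StrictAntiOn (freeEnergy β K) (Icc 0 m))
    (hmono : StrictMonoOn (freeEnergy β K) (Ici m)) : equilibriumSet β K = {m, -m} := by
  have hpos : ∀ x, 0 ≤ x → x ≠ m → freeEnergy β K m < freeEnergy β K x := by
    intro x hx hne
    rcases lt_or_gt_of_ne hne with h | h
    · exact hanti ⟨hx, h.le⟩ ⟨hm.le, le_rfl⟩ h
    · exact hmono self_mem_Ici h.le h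
  refine equilibriumSet_eq hcrit fun x h1 h2 => ?_
  rcases le_total 0 x with h | h
  · exact hpos x h h1
  · rw [← freeEnergy_neg β K x]
    exact hpos (-x) (by linarith) fun h => h2 (by linarith)


/-! ### Uniform Taylor estimates -/

/-- Averaging the order-6 bounds for e^t and e^(-t) cancels the odd terms; the remainder constant
7/4320 is below 1/100. -/
theorem abs_cosh_sub_taylor_le {t : ℝ} (ht : |t| ≤ 1) :
    |cosh t - (1 + t ^ 2 / 2 + t ^ 4 / 24)| ≤ (t ^ 2) ^ 3 / 100 := by
  have h1 := Real.exp_bound ht (n := 6) (by norm_num)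
  have h2 := Real.exp_bound (x := -t) (by rwa [abs_neg]) (n := 6) (by norm_num)
  have h6 : |t| ^ 6 = (t ^ 2) ^ 3 := by
    rw [← pow_mul, Even.pow_abs (by decide)]
  rw [abs_neg] at h2
  rw [h6, abs_le] at h1 h2
  simp only [Finset.sum_range_succ, Finset.sum_range_zero, Nat.factorial] at h1 h2
  norm_num at h1 h2
  have h0 : 0 ≤ (t ^ 2) ^ 3 := by positivity
  rw [cosh_eq, abs_le]
  constructor <;> nlinarith

/-- Fourth-order Taylor expansion of the cumulant generating function, uniformly in `β`. -/
theorem abs_cumulant_sub_taylor_le (β : ℝ) {t : ℝ} (ht : t ^ 2 ≤ 1) :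
    |cumulant β t - (spinVariance β * t ^ 2 / 2 +
      (spinVariance β - 3 * spinVariance β ^ 2) * t ^ 4 / 24)| ≤ (t ^ 2) ^ 3 := by
  have hr := abs_cosh_sub_taylor_le (sq_le_one_iff_abs_le_one t |>.1 ht)
  have hq0 : 0 ≤ cosh t - 1 := sub_nonneg.2 (one_le_cosh t)
  have hp0 := spinVariance_pos β
  have hp1 := spinVariance_lt_one β
  rw [cumulant_eq_log_cosh]
  have ht4 : t ^ 4 = (t ^ 2) ^ 2 := by ring
  rw [ht4] at hr ⊢
  have hu0 : 0 ≤ t ^ 2 := sq_nonneg t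
  generalize t ^ 2 = u at *
  generalize spinVariance β = p at *
  generalize cosh t = c at *
  obtain ⟨q, rfl⟩ : ∃ q, c = 1 + q := ⟨c - 1, by ring⟩
  simp only [add_sub_cancel_left] at *
  have hu2 : u ^ 2 ≤ u := by nlinarith
  have hu3 : u ^ 3 ≤ u ^ 2 := by nlinarith [sq_nonneg u]
  have hu3' : 0 ≤ u ^ 3 := by positivity
  obtain ⟨r, rfl⟩ : ∃ r, q = u / 2 + u ^ 2 / 24 + r := ⟨q - (u / 2 + u ^ 2 / 24), by ring⟩
  rw [show 1 + (u / 2 + u ^ 2 / 24 + r) - (1 + u / 2 + u ^ 2 / 24) = r by ring] at hr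
  obtain ⟨hr1, hr2⟩ := abs_le.1 hr
  set q := u / 2 + u ^ 2 / 24 + r with hq
  have hq1 : q ≤ 3 / 5 * u := by linarith
  have hw0 : 0 ≤ p * q := by positivity
  have hw1 : p * q ≤ 3 / 5 * u := by nlinarith
  -- Expand log(1 + w) to second order at w = pq ≤ 3u/5 ≤ 3/5; the remainder is at most
  -- (3/5)³u³/(2/5) = 27u³/50.
  have hlog := abs_log_sub_add_sum_range_le (x := -(p * q))
    (by rw [abs_neg, abs_of_nonneg hw0]; linarith) 2
  rw [abs_neg, abs_of_nonneg hw0, sub_neg_eq_add] at hlog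
  simp only [Finset.sum_range_succ, Finset.sum_range_zero] at hlog
  norm_num at hlog
  have hlog' : (p * q) ^ 3 / (1 - p * q) ≤ 27 / 50 * u ^ 3 := by
    have h3 : (p * q) ^ 3 ≤ (3 / 5 * u) ^ 3 := by gcongr
    rw [div_le_iff₀ (by linarith)]
    nlinarith
  have hsq : |q ^ 2 - u ^ 2 / 4| ≤ 7 / 100 * u ^ 3 := by
    have ha : |q - u / 2| ≤ 3 / 50 * u ^ 2 := by
      rw [abs_le]; constructor <;> nlinarith
    have hb : |q + u / 2| ≤ 11 / 10 * u := by
      rw [abs_of_nonneg (by positivity)]; linarith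
    calc |q ^ 2 - u ^ 2 / 4| = |q - u / 2| * |q + u / 2| := by rw [← abs_mul]; ring_nf
      _ ≤ 3 / 50 * u ^ 2 * (11 / 10 * u) := by gcongr
      _ ≤ _ := by nlinarith
  have hpr : |p * r| ≤ u ^ 3 / 100 := by
    rw [abs_mul, abs_of_pos hp0]; nlinarith [abs_nonneg r]
  have hps : |p ^ 2 / 2 * (q ^ 2 - u ^ 2 / 4)| ≤ 7 / 100 * u ^ 3 := by
    rw [abs_mul, abs_of_nonneg (by positivity)]
    have hp2 : p ^ 2 / 2 ≤ 1 := by nlinarith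
    exact (mul_le_of_le_one_left (abs_nonneg _) hp2).trans hsq
  have e1 := abs_le.1 (hlog.trans hlog')
  have e2 := abs_le.1 hpr
  have e3 := abs_le.1 hps
  -- The three errors add up to (54 + 1 + 7)/100 · u³, within the claimed u³.
  have hid : p * u / 2 + (p - 3 * p ^ 2) * u ^ 2 / 24 =
      p * q - (p * q) ^ 2 / 2 - p * r + p ^ 2 / 2 * (q ^ 2 - u ^ 2 / 4) := by
    rw [hq]; ring
  rw [hid, abs_le]
  constructor <;> nlinarith

/-- Quartic approximation of `M⁴ G_{β,K}(x / M)`, with an explicit error bound of order `M⁻²`. -/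
theorem abs_scaled_freeEnergy_sub_le (β K x : ℝ) {M : ℝ} (hM : 0 < M)
    (hsmall : 4 * (β * K) ^ 2 * x ^ 2 * (M ^ 2)⁻¹ ≤ 1) :
    |M ^ 4 * freeEnergy β K (x / M) -
      (M ^ 2 * (β * K * (1 - 2 * (β * K) * spinVariance β)) * x ^ 2 +
        -(2 / 3) * (β * K) ^ 4 * (spinVariance β - 3 * spinVariance β ^ 2) * x ^ 4)| ≤
      64 * (β * K) ^ 6 * (x ^ 2) ^ 3 * (M ^ 2)⁻¹ := by
  have ht : (2 * β * K * (x / M)) ^ 2 = 4 * (β * K) ^ 2 * x ^ 2 * (M ^ 2)⁻¹ := by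
    field_simp; ring
  have h := abs_cumulant_sub_taylor_le β (t := 2 * β * K * (x / M)) (by rw [ht]; exact hsmall)
  rw [ht] at h
  rw [abs_sub_comm] at h
  have h' := mul_le_mul_of_nonneg_left h (by positivity : 0 ≤ M ^ 4)
  rw [← abs_of_pos (by positivity : 0 < M ^ 4), ← abs_mul, abs_of_pos (by positivity : 0 < M ^ 4)]
    at h'
  refine (le_of_eq ?_).trans (h'.trans (le_of_eq ?_))
  · congr 1
    unfold freeEnergy
    field_simp
    ring
  · field_simp
    ring

/-! ### The scaling limit -/

theorem continuous_spinVariance : Continuous spinVariance := by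
  unfold spinVariance
  exact continuous_const.div (by fun_prop) fun β => by positivity

/-- Equivalently 2βKp = 1: the second-order curve is where the quadratic coefficient of G vanishes.
-/
theorem mul_criticalK {β : ℝ} (hβ : β ≠ 0) : β * criticalK β = (2 * spinVariance β)⁻¹ := by
  unfold criticalK spinVariance
  field_simp
  ring

theorem quarticCoeff_eq {β : ℝ} (hβ : β ≠ 0) : quarticCoeff β =
    -(2 / 3) * (β * criticalK β) ^ 4 * (spinVariance β - 3 * spinVariance β ^ 2) := by
  rw [mul_criticalK hβ]
  unfold quarticCoeff spinVariance
  have : exp β + 2 ≠ 0 := by positivity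
  simp only [Nat.factorial]
  field_simp
  norm_num
  ring

theorem quarticCoeff_pos {β : ℝ} (h : β < criticalBeta) : 0 < quarticCoeff β := by
  have h4 : exp β < 4 := by
    have := exp_lt_exp.2 h
    rwa [criticalBeta, exp_log (by norm_num)] at this
  have : 0 < 4 - exp β := by linarith
  unfold quarticCoeff
  positivity

theorem hasDerivAt_criticalK {β : ℝ} (hβ : β ≠ 0) :
    HasDerivAt criticalK (deriv criticalK β) β := by
  have : DifferentiableAt ℝ criticalK β := by
    unfold criticalK
    exact ((differentiableAt_exp).add_const 2).div (differentiableAt_id.const_mul 4) (by simpa)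
  exact this.hasDerivAt

theorem tendsto_natCast_rpow_atTop {α : ℝ} (hα : 0 < α) :
    Tendsto (fun n : ℕ => (n : ℝ) ^ α) atTop atTop :=
  (tendsto_rpow_atTop hα).comp tendsto_natCast_atTop_atTop

theorem tendsto_betaSeq (β b : ℝ) {α : ℝ} (hα : 0 < α) :
    Tendsto (betaSeq β b α) atTop (𝓝 β) := by
  have h := ((tendsto_const_nhds (x := b)).div_atTop
    (tendsto_natCast_rpow_atTop hα)).const_add β
  rwa [add_zero] at h

theorem tendsto_kSeq (β k : ℝ) {α : ℝ} (hα : 0 < α) :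
    Tendsto (kSeq β k α) atTop (𝓝 (criticalK β)) := by
  have h := ((tendsto_const_nhds (x := k)).div_atTop
    (tendsto_natCast_rpow_atTop hα)).const_add (criticalK β)
  rwa [add_zero] at h

theorem tendsto_scaled_criticalK_sub {β α : ℝ} (b k : ℝ) (hβ : β ≠ 0) (hα : 0 < α) :
    Tendsto (fun n : ℕ => (n : ℝ) ^ α * (criticalK (betaSeq β b α n) - kSeq β k α n)) atTop
      (𝓝 (deriv criticalK β * b - k)) := by
  -- Differentiating in the step h = n^(-α), rather than in β, treats b = 0 along with b = ±1.
  have hd : HasDerivAt (fun h : ℝ => criticalK (β + b * h)) (deriv criticalK β * b) 0 := by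
    have h1 : HasDerivAt (fun h : ℝ => β + b * h) b 0 := by
      simpa using ((hasDerivAt_id' (0 : ℝ)).const_mul b).const_add β
    have h2 : HasDerivAt criticalK (deriv criticalK β) (β + b * 0) := by
      simpa using hasDerivAt_criticalK hβ
    exact h2.comp 0 h1
  have hN := tendsto_natCast_rpow_atTop hα
  have hpos : ∀ᶠ n : ℕ in atTop, 0 < (n : ℝ) ^ α := hN.eventually_gt_atTop 0
  have hh : Tendsto (fun n : ℕ => ((n : ℝ) ^ α)⁻¹) atTop (𝓝[≠] 0) :=
    tendsto_nhdsWithin_iff.2 ⟨tendsto_inv_atTop_zero.comp hN,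
      hpos.mono fun n hn => (inv_pos.2 hn).ne'⟩
  refine ((hd.tendsto_slope_zero.comp hh).sub_const k).congr' ?_
  filter_upwards [hpos] with n hn
  simp only [Function.comp, zero_add, mul_zero, add_zero, inv_inv, smul_eq_mul, betaSeq, kSeq,
    div_eq_mul_inv]
  field_simp
  ring

/-- The scaled free-energy functional converges to the Ginzburg-Landau polynomial, uniformly on
compact sets. -/
theorem tendstoUniformlyOn_scaled_freeEnergy {β α : ℝ} (b k : ℝ) (hβ : 0 < β) (hα : 0 < α)
    {C : Set ℝ} (hC : IsCompact C) :
    TendstoUniformlyOn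
      (fun (n : ℕ) (x : ℝ) => (n : ℝ) ^ (2 * α) *
        freeEnergy (betaSeq β b α n) (kSeq β k α n) (x / (n : ℝ) ^ (α / 2)))
      (ginzburgLandau β b k) atTop C := by
  obtain ⟨R, hR⟩ := hC.isBounded.exists_norm_le
  have hS : ∀ x ∈ C, x ^ 2 ≤ R ^ 2 := fun x hx => by
    have := hR x hx
    rw [Real.norm_eq_abs] at this
    exact sq_le_sq' (abs_le.1 this).1 (abs_le.1 this).2
  set A : ℕ → ℝ := fun n => betaSeq β b α n * kSeq β k α n with hA
  set p : ℕ → ℝ := fun n => spinVariance (betaSeq β b α n) with hp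
  set h : ℕ → ℝ := fun n => ((n : ℝ) ^ α)⁻¹ with hh
  have hβt := tendsto_betaSeq β b hα
  have hAt : Tendsto A atTop (𝓝 (β * criticalK β)) := hβt.mul (tendsto_kSeq β k hα)
  have hpt : Tendsto p atTop (𝓝 (spinVariance β)) :=
    (continuous_spinVariance.tendsto β).comp hβt
  have hht : Tendsto h atTop (𝓝 0) :=
    tendsto_inv_atTop_zero.comp (tendsto_natCast_rpow_atTop hα)
  have hpβ := spinVariance_pos β
  -- Since 2 p_n β_n K(β_n) = 1, the quadratic coefficient equals 2 A_n p_n β_n (K(β_n) - K_n)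
  -- exactly.
  have hat : Tendsto (fun n : ℕ => (n : ℝ) ^ α * (A n * (1 - 2 * A n * p n))) atTop
      (𝓝 (β * (deriv criticalK β * b - k))) := by
    have h1 := ((hAt.const_mul 2).mul (hpt.mul hβt)).mul
      (tendsto_scaled_criticalK_sub b k hβ.ne' hα)
    have h2 : 2 * (β * criticalK β) * (spinVariance β * β) = β := by
      rw [mul_criticalK hβ.ne']; field_simp
    rw [h2] at h1
    refine h1.congr' ?_
    filter_upwards [hβt.eventually_ne hβ.ne'] with n hn
    have h3 := mul_criticalK hn
    have h4 : 2 * p n * (betaSeq β b α n * criticalK (betaSeq β b α n)) = 1 := by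
      rw [h3]; exact mul_inv_cancel₀ (mul_pos two_pos (spinVariance_pos _)).ne'
    simp only [hA] at *
    linear_combination ((n : ℝ) ^ α * (betaSeq β b α n * kSeq β k α n)) * h4
  have hdt : Tendsto (fun n => -(2 / 3) * A n ^ 4 * (p n - 3 * p n ^ 2)) atTop
      (𝓝 (quarticCoeff β)) := by
    rw [quarticCoeff_eq hβ.ne']
    exact ((hAt.pow 4).const_mul _).mul (hpt.sub ((hpt.pow 2).const_mul 3))
  have hsmall : Tendsto (fun n => 4 * A n ^ 2 * R ^ 2 * h n) atTop (𝓝 0) := by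
    simpa using (((hAt.pow 2).const_mul 4).mul_const (R ^ 2)).mul hht
  -- A bound uniform over |x| ≤ R: quadratic coefficient error, quartic coefficient error, Taylor
  -- remainder.
  have herr : Tendsto (fun n : ℕ =>
      |(n : ℝ) ^ α * (A n * (1 - 2 * A n * p n)) - β * (deriv criticalK β * b - k)| * R ^ 2 +
      |-(2 / 3) * A n ^ 4 * (p n - 3 * p n ^ 2) - quarticCoeff β| * (R ^ 2) ^ 2 +
      64 * A n ^ 6 * (R ^ 2) ^ 3 * h n) atTop (𝓝 0) := by
    have h1 := ((hat.sub_const (β * (deriv criticalK β * b - k))).abs).mul_const (R ^ 2)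
    have h2 := ((hdt.sub_const (quarticCoeff β)).abs).mul_const ((R ^ 2) ^ 2)
    have h3 := (((hAt.pow 6).const_mul 64).mul_const ((R ^ 2) ^ 3)).mul hht
    simpa using (h1.add h2).add h3
  rw [Metric.tendstoUniformlyOn_iff]
  intro ε hε
  filter_upwards [herr.eventually_lt_const hε, hsmall.eventually_le_const one_pos,
    eventually_gt_atTop 0] with n hn hs hn0 x hx
  refine lt_of_le_of_lt ?_ hn
  have hn0' : (0 : ℝ) < n := by exact_mod_cast hn0
  have hM2 : ((n : ℝ) ^ (α / 2)) ^ 2 = (n : ℝ) ^ α := by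
    rw [← rpow_natCast, ← rpow_mul hn0'.le]; norm_num
  have hM4 : ((n : ℝ) ^ (α / 2)) ^ 4 = (n : ℝ) ^ (2 * α) := by
    rw [← rpow_natCast, ← rpow_mul hn0'.le]; congr 1; norm_num; ring
  have hhn : 0 < h n := inv_pos.2 (rpow_pos_of_pos hn0' α)
  have hx2 := hS x hx
  have hmain := abs_scaled_freeEnergy_sub_le (betaSeq β b α n) (kSeq β k α n) x
    (rpow_pos_of_pos hn0' (α / 2)) (by
      rw [hM2]
      refine le_trans ?_ hs
      change 4 * A n ^ 2 * x ^ 2 * h n ≤ _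
      gcongr)
  rw [hM2, hM4] at hmain
  change |_ - ((n : ℝ) ^ α * (A n * (1 - 2 * A n * p n)) * x ^ 2 +
    -(2 / 3) * A n ^ 4 * (p n - 3 * p n ^ 2) * x ^ 4)| ≤ 64 * A n ^ 6 * (x ^ 2) ^ 3 * h n at hmain
  rw [dist_comm, Real.dist_eq, ginzburgLandau]
  have hA6 : 0 ≤ A n ^ 6 := Even.pow_nonneg (by decide) _
  have hx4 : x ^ 4 = (x ^ 2) ^ 2 := by ring
  calc |(n : ℝ) ^ (2 * α) * freeEnergy (betaSeq β b α n) (kSeq β k α n) (x / (n : ℝ) ^ (α / 2)) -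
        (β * (deriv criticalK β * b - k) * x ^ 2 + quarticCoeff β * x ^ 4)|
      = |((n : ℝ) ^ α * (A n * (1 - 2 * A n * p n)) - β * (deriv criticalK β * b - k)) * x ^ 2 +
        (-(2 / 3) * A n ^ 4 * (p n - 3 * p n ^ 2) - quarticCoeff β) * (x ^ 2) ^ 2 +
        ((n : ℝ) ^ (2 * α) *
          freeEnergy (betaSeq β b α n) (kSeq β k α n) (x / (n : ℝ) ^ (α / 2)) -
          ((n : ℝ) ^ α * (A n * (1 - 2 * A n * p n)) * x ^ 2 +
            -(2 / 3) * A n ^ 4 * (p n - 3 * p n ^ 2) * x ^ 4))| := by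
        congr 1; ring
    _ ≤ |(n : ℝ) ^ α * (A n * (1 - 2 * A n * p n)) - β * (deriv criticalK β * b - k)| * x ^ 2 +
        |-(2 / 3) * A n ^ 4 * (p n - 3 * p n ^ 2) - quarticCoeff β| * (x ^ 2) ^ 2 +
        64 * A n ^ 6 * (x ^ 2) ^ 3 * h n := by
        refine (abs_add_three _ _ _).trans ?_
        rw [abs_mul, abs_mul, abs_of_nonneg (sq_nonneg x), abs_of_nonneg (sq_nonneg (x ^ 2))]
        exact add_le_add_right hmain _
    _ ≤ _ := by gcongr


/-! ### Minimum points of the Ginzburg-Landau polynomial -/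

/-- This is g'(x̄) = 0 divided by 2x̄. -/
theorem sq_xBar {β b k : ℝ} (hβ : 0 < β) (hβc : β < criticalBeta)
    (h : deriv criticalK β * b - k < 0) :
    2 * quarticCoeff β * xBar β b k ^ 2 = -(β * (deriv criticalK β * b - k)) := by
  have hc := quarticCoeff_pos hβc
  have hd : 0 < k - deriv criticalK β * b := by linarith
  rw [xBar, sq_sqrt (by positivity)]
  field_simp
  ring

theorem xBar_pos {β b k : ℝ} (hβ : 0 < β) (hβc : β < criticalBeta)
    (h : deriv criticalK β * b - k < 0) : 0 < xBar β b k := by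
  have hc := quarticCoeff_pos hβc
  have hd : 0 < k - deriv criticalK β * b := by linarith
  rw [xBar]
  positivity

/-- Completing the square in the Ginzburg-Landau polynomial. -/
theorem ginzburgLandau_eq {β b k : ℝ} (hβ : 0 < β) (hβc : β < criticalBeta)
    (h : deriv criticalK β * b - k < 0) (x : ℝ) :
    ginzburgLandau β b k x = ginzburgLandau β b k (xBar β b k) +
      quarticCoeff β * (x ^ 2 - xBar β b k ^ 2) ^ 2 := by
  have := sq_xBar hβ hβc h
  unfold ginzburgLandau
  linear_combination (x ^ 2 - xBar β b k ^ 2) * this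

theorem ginzburgLandau_xBar_lt {β b k x : ℝ} (hβ : 0 < β) (hβc : β < criticalBeta)
    (h : deriv criticalK β * b - k < 0) (hx : 0 ≤ x) (hne : x ≠ xBar β b k) :
    ginzburgLandau β b k (xBar β b k) < ginzburgLandau β b k x := by
  rw [ginzburgLandau_eq hβ hβc h x]
  have hc := quarticCoeff_pos hβc
  have hne' : x ^ 2 - xBar β b k ^ 2 ≠ 0 := fun h0 =>
    hne ((sq_eq_sq₀ hx (xBar_pos hβ hβc h).le).1 (sub_eq_zero.1 h0))
  have : 0 < (x ^ 2 - xBar β b k ^ 2) ^ 2 := by positivity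
  linarith [mul_pos hc this]

theorem setOf_isGlobalMinPoint_ginzburgLandau {β b k : ℝ} (hβ : 0 < β) (hβc : β < criticalBeta)
    (h : deriv criticalK β * b - k < 0) :
    {x : ℝ | IsGlobalMinPoint (ginzburgLandau β b k) x} = {xBar β b k, -xBar β b k} := by
  have hc := quarticCoeff_pos hβc
  ext x
  simp only [mem_ofPred_eq, mem_insert_iff, mem_singleton_iff]
  rw [← sq_eq_sq_iff_eq_or_eq_neg]
  constructor
  · intro hx
    have h1 := hx (xBar β b k)
    rw [ginzburgLandau_eq hβ hβc h x] at h1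
    have h2 : (x ^ 2 - xBar β b k ^ 2) ^ 2 ≤ 0 := by
      by_contra! h3
      linarith [mul_pos hc h3]
    have h3 := pow_eq_zero_iff two_ne_zero |>.1 (le_antisymm h2 (sq_nonneg _))
    linarith
  · intro hx y
    rw [ginzburgLandau_eq hβ hβc h x, ginzburgLandau_eq hβ hβc h y, hx]
    have : 0 ≤ quarticCoeff β * (y ^ 2 - xBar β b k ^ 2) ^ 2 := by positivity
    linarith

theorem exists_isGlobalMinPoint_ginzburgLandau_iff {β b k : ℝ} (hβ : 0 < β)
    (hβc : β < criticalBeta) :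
    (∃ x : ℝ, x ≠ 0 ∧ IsGlobalMinPoint (ginzburgLandau β b k) x) ↔
      deriv criticalK β * b - k < 0 := by
  constructor
  · rintro ⟨x, hx0, hx⟩
    by_contra! hd
    have h0 := hx 0
    have h4 : 0 < quarticCoeff β * x ^ 4 := mul_pos (quarticCoeff_pos hβc) (by positivity)
    have h2 : 0 ≤ β * (deriv criticalK β * b - k) * x ^ 2 := by positivity
    simp only [ginzburgLandau] at h0
    norm_num at h0
    linarith
  · intro h
    refine ⟨xBar β b k, (xBar_pos hβ hβc h).ne', ?_⟩
    have : xBar β b k ∈ {x : ℝ | IsGlobalMinPoint (ginzburgLandau β b k) x} := by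
      rw [setOf_isGlobalMinPoint_ginzburgLandau hβ hβc h]
      exact mem_insert _ _
    exact this

/-! ### Asymptotics of the magnetization -/

theorem tendsto_scaled_freeEnergy {β α : ℝ} (b k : ℝ) (hβ : 0 < β) (hα : 0 < α) (x : ℝ) :
    Tendsto (fun n : ℕ => (n : ℝ) ^ (2 * α) *
      freeEnergy (betaSeq β b α n) (kSeq β k α n) (x / (n : ℝ) ^ (α / 2))) atTop
      (𝓝 (ginzburgLandau β b k x)) :=
  (tendstoUniformlyOn_scaled_freeEnergy b k hβ hα isCompact_singleton).tendsto_at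
    (mem_singleton x)

theorem eventually_scaled_freeEnergy_lt {β α : ℝ} (b k : ℝ) (hβ : 0 < β) (hα : 0 < α) {x y : ℝ}
    (h : ginzburgLandau β b k x < ginzburgLandau β b k y) :
    ∀ᶠ n : ℕ in atTop,
      freeEnergy (betaSeq β b α n) (kSeq β k α n) (x / (n : ℝ) ^ (α / 2)) <
        freeEnergy (betaSeq β b α n) (kSeq β k α n) (y / (n : ℝ) ^ (α / 2)) := by
  filter_upwards [(tendsto_scaled_freeEnergy b k hβ hα x).eventually_lt
    (tendsto_scaled_freeEnergy b k hβ hα y) h] with n hn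
  exact lt_of_mul_lt_mul_left hn (rpow_nonneg n.cast_nonneg _)

/-- For large `n`, the functional `G_{β_n,K_n}` is unimodal on `[0, ∞)` with positive critical
minimum point `m(β_n,K_n)`, and the equilibrium macrostates are `±m(β_n,K_n)`. -/
theorem eventually_magnetization_spec {β α b k : ℝ} (hβ : 0 < β) (hβc : β < criticalBeta)
    (hα : 0 < α) (h : deriv criticalK β * b - k < 0) :
    ∀ᶠ n : ℕ in atTop,
      0 < magnetization (betaSeq β b α n) (kSeq β k α n) ∧
      equilibriumSet (betaSeq β b α n) (kSeq β k α n) =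
        {magnetization (betaSeq β b α n) (kSeq β k α n),
          -magnetization (betaSeq β b α n) (kSeq β k α n)} ∧
      StrictAntiOn (freeEnergy (betaSeq β b α n) (kSeq β k α n))
        (Icc 0 (magnetization (betaSeq β b α n) (kSeq β k α n))) ∧
      StrictMonoOn (freeEnergy (betaSeq β b α n) (kSeq β k α n))
        (Ici (magnetization (betaSeq β b α n) (kSeq β k α n))) := by
  have hx := xBar_pos hβ hβc h
  have hβt := tendsto_betaSeq β b hα
  have hA : 0 < β * criticalK β := by
    rw [mul_criticalK hβ.ne']
    exact inv_pos.2 (mul_pos two_pos (spinVariance_pos β))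
  filter_upwards [hβt.eventually_lt_const hβc,
    (hβt.mul (tendsto_kSeq β k hα)).eventually_const_lt hA,
    -- Comparing x̄ with 0 makes G_n negative at x̄/n^(α/2), the input for unimodality.
    eventually_scaled_freeEnergy_lt b k hβ hα (ginzburgLandau_xBar_lt hβ hβc h le_rfl hx.ne),
    eventually_gt_atTop 0] with n h1 h2 h3 h4
  rw [zero_div, freeEnergy_zero] at h3
  have h4' : (0 : ℝ) < n := by exact_mod_cast h4
  obtain ⟨m, hm, hcrit, hanti, hmono⟩ :=
    exists_freeEnergy_unimodal h1 h2 (div_pos hx (rpow_pos_of_pos h4' _)) h3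
  have heq := equilibriumSet_eq_of_unimodal hm hcrit hanti hmono
  rw [magnetization_eq hm heq]
  exact ⟨hm, heq, hanti, hmono⟩

/-- If the scaled minimum lay on the far side of a from x̄, monotonicity of G_n between them would
rank a below x̄, contradicting g(x̄) < g(a). -/
theorem tendsto_scaled_magnetization {β α b k : ℝ} (hβ : 0 < β) (hβc : β < criticalBeta)
    (hα : 0 < α) (h : deriv criticalK β * b - k < 0) :
    Tendsto (fun n : ℕ => (n : ℝ) ^ (α / 2) * magnetization (betaSeq β b α n) (kSeq β k α n))
      atTop (𝓝 (xBar β b k)) := by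
  have hx := xBar_pos hβ hβc h
  refine tendsto_order.2 ⟨fun a ha => ?_, fun a ha => ?_⟩
  -- Truncation at 0 keeps the test point in [0, ∞), where x̄ is the only minimum point of g.
  · have ha' : max a 0 < xBar β b k := max_lt ha hx
    filter_upwards [eventually_magnetization_spec hβ hβc hα h, eventually_gt_atTop 0,
      eventually_scaled_freeEnergy_lt b k hβ hα
        (ginzburgLandau_xBar_lt hβ hβc h (le_max_right a 0) ha'.ne)] with n hspec hn hlt
    have hM : (0 : ℝ) < (n : ℝ) ^ (α / 2) := rpow_pos_of_pos (by exact_mod_cast hn) _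
    refine (le_max_left a 0).trans_lt ?_
    by_contra! hle
    have h1 : magnetization (betaSeq β b α n) (kSeq β k α n) ≤ max a 0 / (n : ℝ) ^ (α / 2) := by
      rw [le_div_iff₀ hM]; linarith
    have h2 : max a 0 / (n : ℝ) ^ (α / 2) < xBar β b k / (n : ℝ) ^ (α / 2) := by gcongr
    exact lt_asymm hlt (hspec.2.2.2 h1 (h1.trans h2.le) h2)
  · filter_upwards [eventually_magnetization_spec hβ hβc hα h, eventually_gt_atTop 0,
      eventually_scaled_freeEnergy_lt b k hβ hα
        (ginzburgLandau_xBar_lt hβ hβc h (hx.trans ha).le ha.ne')] with n hspec hn hlt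
    have hM : (0 : ℝ) < (n : ℝ) ^ (α / 2) := rpow_pos_of_pos (by exact_mod_cast hn) _
    by_contra! hle
    have h1 : a / (n : ℝ) ^ (α / 2) ≤ magnetization (betaSeq β b α n) (kSeq β k α n) := by
      rw [div_le_iff₀ hM]; linarith
    have h2 : xBar β b k / (n : ℝ) ^ (α / 2) < a / (n : ℝ) ^ (α / 2) := by gcongr
    have h3 : 0 < xBar β b k / (n : ℝ) ^ (α / 2) := div_pos hx hM
    exact lt_asymm hlt (hspec.2.2.1 ⟨h3.le, h2.le.trans h1⟩ ⟨(h3.trans h2).le, h1⟩ h2)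

theorem isEquivalent_magnetization {β α b k : ℝ} (hβ : 0 < β) (hβc : β < criticalBeta)
    (hα : 0 < α) (h : deriv criticalK β * b - k < 0) :
    (fun n : ℕ => magnetization (betaSeq β b α n) (kSeq β k α n)) ~[atTop]
      (fun n : ℕ => xBar β b k / (n : ℝ) ^ (α / 2)) := by
  have hx := xBar_pos hβ hβc h
  have h1 := (isEquivalent_const_iff_tendsto hx.ne').2 (tendsto_scaled_magnetization hβ hβc hα h)
  have h2 := h1.div (IsEquivalent.refl (u := fun n : ℕ => (n : ℝ) ^ (α / 2)))
  refine h2.congr_left ?_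
  filter_upwards [eventually_gt_atTop 0] with n hn
  have hM : (0 : ℝ) < (n : ℝ) ^ (α / 2) := rpow_pos_of_pos (by exact_mod_cast hn) _
  exact mul_div_cancel_left₀ _ hM.ne'

/-- Valid for every n, so the comparison sequence can be rewritten as a function, not just
eventually. -/
theorem abs_sub_betaSeq_rpow {β α b : ℝ} (hb : |b| = 1) (n : ℕ) :
    |β - betaSeq β b α n| ^ (1 / 2 : ℝ) = ((n : ℝ) ^ (α / 2))⁻¹ := by
  have hn : (0 : ℝ) ≤ n := n.cast_nonneg
  rw [betaSeq, sub_add_cancel_left, abs_neg, abs_div, hb, abs_of_nonneg (rpow_nonneg hn α),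
    one_div, inv_rpow (rpow_nonneg hn α), ← rpow_mul hn]
  ring_nf

end BlumeCapel

end

theorem theorem3p1 (β α b k : ℝ) (hβ : β ∈ Ioo 0 BlumeCapel.criticalBeta) (hα : 0 < α)
    (hb : b ∈ ({1, 0, -1} : Set ℝ)) (hk : k ≠ deriv BlumeCapel.criticalK β * b) :
    -- the sequence converges to the second-order point
    Tendsto (fun n : ℕ => (BlumeCapel.betaSeq β b α n, BlumeCapel.kSeq β k α n)) atTop
      (𝓝 (β, BlumeCapel.criticalK β)) ∧
    -- (a) scaling limit of the free-energy functional, uniformly on compact sets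
    (∀ C : Set ℝ, IsCompact C →
      TendstoUniformlyOn
        (fun (n : ℕ) (x : ℝ) => (n : ℝ) ^ (2 * α) *
          BlumeCapel.freeEnergy (BlumeCapel.betaSeq β b α n) (BlumeCapel.kSeq β k α n)
            (x / (n : ℝ) ^ (α / 2)))
        (BlumeCapel.ginzburgLandau β b k) atTop C) ∧
    -- (b) global minimum points of the limit
    ((∃ x : ℝ, x ≠ 0 ∧ BlumeCapel.IsGlobalMinPoint (BlumeCapel.ginzburgLandau β b k) x) ↔
      deriv BlumeCapel.criticalK β * b - k < 0) ∧
    (deriv BlumeCapel.criticalK β * b - k < 0 →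
      0 < BlumeCapel.xBar β b k ∧
      {x : ℝ | BlumeCapel.IsGlobalMinPoint (BlumeCapel.ginzburgLandau β b k) x} =
        {BlumeCapel.xBar β b k, -BlumeCapel.xBar β b k}) ∧
    -- (c) asymptotics of the magnetization, which is well defined for all large `n`
    (deriv BlumeCapel.criticalK β * b - k < 0 →
      (∀ᶠ n : ℕ in atTop,
        0 < BlumeCapel.magnetization (BlumeCapel.betaSeq β b α n) (BlumeCapel.kSeq β k α n) ∧
        BlumeCapel.equilibriumSet (BlumeCapel.betaSeq β b α n) (BlumeCapel.kSeq β k α n) =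
          {BlumeCapel.magnetization (BlumeCapel.betaSeq β b α n) (BlumeCapel.kSeq β k α n),
            -BlumeCapel.magnetization (BlumeCapel.betaSeq β b α n)
              (BlumeCapel.kSeq β k α n)}) ∧
      Tendsto (fun n : ℕ => BlumeCapel.magnetization (BlumeCapel.betaSeq β b α n)
        (BlumeCapel.kSeq β k α n)) atTop (𝓝 0) ∧
      (fun n : ℕ => BlumeCapel.magnetization (BlumeCapel.betaSeq β b α n)
        (BlumeCapel.kSeq β k α n)) ~[atTop]
          (fun n : ℕ => BlumeCapel.xBar β b k / (n : ℝ) ^ (α / 2)) ∧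
      Tendsto (fun n : ℕ => (n : ℝ) ^ (α / 2) *
        BlumeCapel.magnetization (BlumeCapel.betaSeq β b α n) (BlumeCapel.kSeq β k α n))
        atTop (𝓝 (BlumeCapel.xBar β b k)) ∧
      (b ≠ 0 →
        (fun n : ℕ => BlumeCapel.magnetization (BlumeCapel.betaSeq β b α n)
          (BlumeCapel.kSeq β k α n)) ~[atTop]
            (fun n : ℕ => BlumeCapel.xBar β b k *
              |β - BlumeCapel.betaSeq β b α n| ^ (1 / 2 : ℝ)))) := by
  obtain ⟨hβ0, hβc⟩ := hβ
  refine ⟨(BlumeCapel.tendsto_betaSeq β b hα).prodMk_nhds (BlumeCapel.tendsto_kSeq β k hα),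
    fun C hC => BlumeCapel.tendstoUniformlyOn_scaled_freeEnergy b k hβ0 hα hC,
    BlumeCapel.exists_isGlobalMinPoint_ginzburgLandau_iff hβ0 hβc,
    fun h => ⟨BlumeCapel.xBar_pos hβ0 hβc h,
      BlumeCapel.setOf_isGlobalMinPoint_ginzburgLandau hβ0 hβc h⟩,
    fun h => ?_⟩
  have hequiv := BlumeCapel.isEquivalent_magnetization hβ0 hβc hα h
  refine ⟨(BlumeCapel.eventually_magnetization_spec hβ0 hβc hα h).mono
      fun n hn => ⟨hn.1, hn.2.1⟩, ?_, hequiv,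
    BlumeCapel.tendsto_scaled_magnetization hβ0 hβc hα h, fun hb0 => ?_⟩
  · exact hequiv.symm.tendsto_nhds (tendsto_const_nhds.div_atTop
      (BlumeCapel.tendsto_natCast_rpow_atTop (half_pos hα)))
  · have hb1 : |b| = 1 := by
      rcases hb with rfl | rfl | rfl
      · simp
      · exact absurd rfl hb0
      · simp
    simp only [BlumeCapel.abs_sub_betaSeq_rpow hb1]
    simpa only [div_eq_mul_inv] using hequiv
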